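/- A ribbon graph $G=(V,E)$ is a (possibly disconnected or non-orientable) surface with boundary, presented as the union of a finite set $V$ of discs (vertices) and a finite set $E$ of discs (edges), such that vertices and edges meet in disjoint line segments, each segment lies on the boundary of exactly one vertex and exactly one edge, and every edge contains exactly two such segments. Ribbon graphs are considered up to equivalence. For $A\subseteq E$ let $k(A)$ and $f(A)$ denote the number of connected components and of boundary components of the spanning ribbon subgraph $(V,A)$, and put $k(G)=k(E)$, $f(G)=f(E)$. The Euler genus of $G$ is $\gamma(G)=2k(G)-|V|+|E|-f(G)$, and $G$ is plane if $\gamma(G)=0$. The geometric dual $G^*$ has the same edges as $G$, and its vertices are discs glued to the boundary components of $G$ (the vertex discs of $G$ being removed). A set system is a pair $D=(E,\mathcal F)$ with $E$ finite and $\mathcal F$ a collection of subsets of $E$, called feasible sets; $D_{\min}$ and $D_{\max}$ are the set systems on $E$ consisting of the feasible sets of minimum, respectively maximum, cardinality, and the dual is $D^*=(E,\{E\setminus X : X\in\mathcal F\})$. A delta-matroid is a set system with $\mathcal F\ne\emptyset$ such that for all $X,Y\in\mathcal F$ and $u\in X\bigtriangleup Y$ there is $v\in X\bigtriangleup Y$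 (possibly $v=u$) with $X\bigtriangleup\{u,v\}\in\mathcal F$; it is a matroid, with $\mathcal F$ its set of bases, if all feasible sets have the same cardinality. For a ribbon graph $G=(V,E)$, let $M(G)$ be its cycle matroid, i.e. the set system on $E$ whose feasible sets are the edge sets of the maximal spanning forests of the underlying graph of $G$, and let $D(G)=(E,\{A\subseteq E : f(A)=k(G)\})$, whose feasible sets are the edge sets of the spanning quasi-trees of $G$. **Corollary.** Let $G$ be a ribbon graph. Then 1. $D(G)_{\min}=M(G)$; 2. $D(G)_{\max}=(M(G^*))^*$; 3. $D(G)=M(G)$ if and only if $G$ is plane; and if $G$ is not plane, then $D(G)$ is not a matroid. -/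

import Mathlib

/-- A set system `(E, 𝓕)` whose ground set consists of all elements of the type `E`. -/
@[ext]
structure SetSystem (E : Type*) where
  /-- The collection `𝓕` of feasible sets. -/
  feasible : Set (Set E)

namespace SetSystem

variable {E : Type*}

/-- The symmetric exchange axiom: for feasible `X, Y` and `u ∈ X ∆ Y` there is `v ∈ X ∆ Y`
(possibly `v = u`) such that `X ∆ {u, v}` is feasible. -/
def SymmetricExchange (D : SetSystem E) : Prop :=
  ∀ X ∈ D.feasible, ∀ Y ∈ D.feasible, ∀ u ∈ symmDiff X Y,
    ∃ v ∈ symmDiff X Y, symmDiff X {u, v} ∈ D.feasible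

/-- A delta-matroid is a proper set system satisfying the symmetric exchange axiom. -/
def IsDeltaMatroid (D : SetSystem E) : Prop :=
  D.feasible.Nonempty ∧ D.SymmetricExchange

/-- A matroid, given by its collection of bases, is a delta-matroid whose feasible sets all have
the same cardinality. -/
def IsMatroid (D : SetSystem E) : Prop :=
  D.IsDeltaMatroid ∧ ∀ X ∈ D.feasible, ∀ Y ∈ D.feasible, X.ncard = Y.ncard

/-- `D_min`: the feasible sets of minimum cardinality. -/
def lower (D : SetSystem E) : SetSystem E where
  feasible := {F | F ∈ D.feasible ∧ ∀ F' ∈ D.feasible, F.ncard ≤ F'.ncard}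

/-- `D_max`: the feasible sets of maximum cardinality. -/
def upper (D : SetSystem E) : SetSystem E where
  feasible := {F | F ∈ D.feasible ∧ ∀ F' ∈ D.feasible, F'.ncard ≤ F.ncard}

/-- The twist `D * A`, with feasible sets `A ∆ X` for `X` feasible in `D`. -/
def twist (D : SetSystem E) (A : Set E) : SetSystem E where
  feasible := {F | ∃ X ∈ D.feasible, F = symmDiff A X}

/-- The dual `D* = D * E`. -/
def dual (D : SetSystem E) : SetSystem E := D.twist Set.univ

end SetSystem

/-- The corners of the edge discs. The boundary circle of an edge disc `e` is made up of two line
segments along which `e` meets vertices (its two *ends*) and of two free arcs (its two *sides*),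
alternately. The corner `(e, i, s)` is the point of `e` where the end `i` and the side `s` meet. -/
abbrev Corner (E : Type*) : Type _ := E × Bool × Bool

namespace Corner

variable {E : Type*}

/-- The corner reached by walking along the side `s` of the edge disc, to its other end. -/
def alongSide (x : Corner E) : Corner E := (x.1, !x.2.1, x.2.2)

/-- The corner reached by walking along the end `i` of the edge disc, to its other side. -/
def alongEnd (x : Corner E) : Corner E := (x.1, x.2.1, !x.2.2)

/-- Interchange the roles of the ends and the sides of an edge disc. -/
def swap (x : Corner E) : Corner E := (x.1, x.2.2, x.2.1)

@[simp]
theorem swap_swap (x : Corner E) : x.swap.swap = x := rfl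

end Corner

/-- A ribbon graph with vertex discs `V` and edge discs `E`, not necessarily connected or
orientable, described (up to equivalence) by how the edge discs are attached to the vertex discs.

The boundary circle of a vertex disc that meets at least one edge consists alternately of line
segments (ends of edges) and of arcs between consecutive line segments. Every corner of an edge is
an endpoint of exactly one such arc; `arc` sends it to the other endpoint of this arc, and `vert`
sends it to the vertex disc it lies on. Two corners lie on the same vertex disc exactly if one
gets from one to the other by walking along arcs and along ends of edges, because the boundary of
the disc is a single circle. The elements of `V` outside the range of `vert` are the isolated
vertices, discs that meet no edge. -/
structure RibbonGraph (V E : Type*) where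
  arc : Corner E → Corner E
  arc_arc : ∀ x, arc (arc x) = x
  arc_ne : ∀ x, arc x ≠ x
  vert : Corner E → V
  vert_eq_iff : ∀ x y, vert x = vert y ↔
    Relation.EqvGen (fun a b => b = arc a ∨ b = a.alongEnd) x y

namespace RibbonGraph

variable {V E : Type*}

/-- The edge `e` joins the vertices `u` and `v` (in either order; `u = v` for a loop). -/
def IsLink (G : RibbonGraph V E) (e : E) (u v : V) : Prop :=
  ∃ i : Bool, G.vert (e, i, false) = u ∧ G.vert (e, !i, false) = v

/-- The connected components of the spanning ribbon subgraph `(V, A)`. -/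
abbrev Component (G : RibbonGraph V E) (A : Set E) : Type _ :=
  Quot fun u v : V => ∃ e ∈ A, G.IsLink e u v

/-- `k(A)`: the number of connected components of `(V, A)`. -/
noncomputable def k (G : RibbonGraph V E) (A : Set E) : ℕ := Nat.card (G.Component A)

/-- At a corner of `e`, the boundary of the surface `(V, A)` leaves the arc of the vertex disc. It
follows the side of `e` if `e` is present, i.e. `e ∈ A`; if `e` has been removed, it follows the
line segment on the boundary of the vertex disc to which `e` was attached. -/
noncomputable def boundaryStep (A : Set E) (x : Corner E) : Corner E :=
  open Classical in if x.1 ∈ A then x.alongSide else x.alongEnd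

/-- The boundary components of the surface `(V, A)`: the closed curves that follow arcs and
`boundaryStep`s alternately, together with the boundary circles of the isolated vertices of `G`. -/
abbrev BoundaryComponent (G : RibbonGraph V E) (A : Set E) : Type _ :=
  (Quot fun x y : Corner E => y = G.arc x ∨ y = boundaryStep A x) ⊕ {v : V // v ∉ Set.range G.vert}

/-- `f(A)`: the number of boundary components of `(V, A)`. -/
noncomputable def f (G : RibbonGraph V E) (A : Set E) : ℕ := Nat.card (G.BoundaryComponent A)

/-- The Euler genus `γ(G) = 2k(G) - χ`, where `χ = v(G) - e(G) + f(G)` is the Euler characteristic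
of the closed surface obtained from `G` by gluing a disc to each boundary component. -/
noncomputable def eulerGenus (G : RibbonGraph V E) : ℤ :=
  2 * G.k Set.univ - (Nat.card V - Nat.card E + G.f Set.univ)

/-- A ribbon graph is plane if its Euler genus is zero (it may be disconnected). -/
def IsPlane (G : RibbonGraph V E) : Prop := G.eulerGenus = 0

/-- The geometric dual `G*`: the boundary components of `G` are capped off with discs, which are
the vertices of `G*`, and the vertex discs of `G` are removed. The edge discs remain the same, but
their sides become ends and conversely; an isolated vertex yields an isolated vertex. -/
def dual (G : RibbonGraph V E) : RibbonGraph (G.BoundaryComponent Set.univ) E where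
  arc x := (G.arc x.swap).swap
  arc_arc x := by simp [G.arc_arc]
  arc_ne x h := G.arc_ne x.swap (by simpa using congrArg Corner.swap h)
  vert x := Sum.inl (Quot.mk _ x.swap)
  vert_eq_iff x y := by
    have key : ∀ a b : Corner E,
        (b.swap = G.arc a.swap ∨ b.swap = boundaryStep Set.univ a.swap) ↔
          (b = (G.arc a.swap).swap ∨ b = a.alongEnd) := by
      intro a b
      have h : boundaryStep Set.univ a.swap = a.alongEnd.swap := by
        simp [boundaryStep, Corner.swap, Corner.alongEnd, Corner.alongSide]
      have hinj : ∀ c d : Corner E, c.swap = d ↔ c = d.swap := fun c d =>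
        ⟨fun h => by rw [← h, Corner.swap_swap], fun h => by rw [h, Corner.swap_swap]⟩
      rw [h, hinj, hinj, Corner.swap_swap]
    rw [Sum.inl.injEq, Quot.eq]
    constructor
    · intro h
      have aux : ∀ p q : Corner E, Relation.EqvGen
          (fun x y => y = G.arc x ∨ y = boundaryStep Set.univ x) p q →
          Relation.EqvGen (fun a b => b = (G.arc a.swap).swap ∨ b = a.alongEnd)
            p.swap q.swap := by
        intro p q h
        induction h with
        | rel p q h => exact .rel _ _ ((key p.swap q.swap).1 h)
        | refl p => exact .refl _
        | symm p q _ ih => exact .symm _ _ ih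
        | trans p q r _ _ ih₁ ih₂ => exact .trans _ _ _ ih₁ ih₂
      exact aux _ _ h
    · intro h
      induction h with
      | rel p q h => exact .rel _ _ ((key p q).2 h)
      | refl p => exact .refl _
      | symm p q _ ih => exact .symm _ _ ih
      | trans p q r _ _ ih₁ ih₂ => exact .trans _ _ _ ih₁ ih₂

/-- `A` contains the edges of a cycle of the underlying graph: distinct vertices `v₀, …, vₙ` and
distinct edges `e₀, …, eₙ` in `A` with `eᵢ` joining `vᵢ` and `vᵢ₊₁` (indices modulo `n + 1`). A
cycle with one edge is a loop, a cycle with two edges is a pair of parallel edges. -/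
def ContainsCycle (G : RibbonGraph V E) (A : Set E) : Prop :=
  ∃ (n : ℕ) (v : Fin (n + 1) → V) (e : Fin (n + 1) → E),
    Function.Injective v ∧ Function.Injective e ∧
      ∀ i, e i ∈ A ∧ G.IsLink (e i) (v i) (v (i + 1))

/-- The spanning subgraph `(V, A)` of the underlying graph is a forest. -/
def IsForest (G : RibbonGraph V E) (A : Set E) : Prop := ¬ G.ContainsCycle A

/-- The cycle matroid `M(G)` of the underlying graph: its bases are the edge sets of the maximal
spanning forests. -/
def cycleMatroid (G : RibbonGraph V E) : SetSystem E where
  feasible := {B | Maximal G.IsForest B}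

/-- The delta-matroid `D(G)`: `A` is feasible if `f(A) = k(G)`, i.e. if `(V, A)` is a spanning
quasi-tree of `G` (it has one boundary component in each connected component of `G`). -/
def deltaMatroid (G : RibbonGraph V E) : SetSystem E where
  feasible := {A | G.f A = G.k Set.univ}

end RibbonGraph

/-! Everything is a count. For every `A`, `k(A) ≤ f(A)`, as each component has boundary, and `|V| ≤
k(A) + |A|`, as an edge merges at most two components. In a forest every edge is a bridge when
added, and a bridge joins two boundary components into one, so `f(A) + |A| ≤ |V|`; thus forests are
exactly the sets with `k(A) + |A| = |V|`, and there `f(A) = k(A)`. A quasi-tree has `k(A) = k(G)`,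
hence at least `|V| - k(G)` edges, with equality exactly for maximal forests
(`mem_cycleMatroid_iff`). This gives the minimum.

Exchanging ends and sides of edges identifies the boundary of `A` in `G` with that of `Aᶜ` in `G*`,
and `k(G*) = k(G)`; so `D(G)` is dual to `D(G*)` and the maximum follows from the minimum. As `G*`
has `f(G)` vertices, the extreme sizes `|V| - k(G)` and `|E| - (f(G) - k(G))` differ by `γ(G)`,
which settles planarity. -/

namespace Nat

/-- The cardinality drops along a surjection that is not injective. -/
theorem card_lt_card_of_surjective_of_eq {α β : Type*} [Finite α] (q : α → β)
    (hq : Function.Surjective q) {a b : α} (hab : a ≠ b) (h : q a = q b) :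
    Nat.card β < Nat.card α := by
  by_contra hle
  exact hab ((hq.bijective_of_nat_card_le (not_lt.1 hle)).1 h)

end Nat

namespace RibbonGraph

variable {V E : Type*} (G : RibbonGraph V E)

/-! ### Corners, vertices and links -/

section Incidence

theorem vert_arc (x : Corner E) : G.vert (G.arc x) = G.vert x :=
  (G.vert_eq_iff _ _).2 (.symm _ _ (.rel _ _ (.inl rfl)))

theorem vert_alongEnd (x : Corner E) : G.vert x.alongEnd = G.vert x :=
  (G.vert_eq_iff _ _).2 (.symm _ _ (.rel _ _ (.inr rfl)))

theorem vert_side (e : E) (i s : Bool) : G.vert (e, i, s) = G.vert (e, i, false) := by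
  cases s
  · rfl
  · exact G.vert_alongEnd (e, i, false)

variable {G}

theorem isLink_vert (e : E) (i : Bool) :
    G.IsLink e (G.vert (e, i, false)) (G.vert (e, !i, false)) := ⟨i, rfl, rfl⟩

theorem IsLink.symm {e : E} {u v : V} (h : G.IsLink e u v) : G.IsLink e v u := by
  obtain ⟨i, rfl, rfl⟩ := h
  exact ⟨!i, rfl, by rw [Bool.not_not]⟩

theorem IsLink.sym2_eq {e : E} {u v : V} (h : G.IsLink e u v) :
    s(u, v) = s(G.vert (e, false, false), G.vert (e, true, false)) := by
  obtain ⟨i, rfl, rfl⟩ := h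
  cases i
  · rfl
  · exact Sym2.eq_swap

end Incidence

/-! ### Connected components under edge insertion -/

section Components

/-- The component of `(V, A)` containing the vertex `v`. -/
def comp (A : Set E) (v : V) : G.Component A := Quot.mk _ v

/-- The two ends of `e` lie in the same component of `(V, A)`. -/
def EndsJoined (A : Set E) (e : E) : Prop :=
  G.comp A (G.vert (e, false, false)) = G.comp A (G.vert (e, true, false))

variable {G}

theorem comp_surjective (A : Set E) : Function.Surjective (G.comp A) := Quot.mk_surjective

theorem IsLink.comp_eq {A : Set E} {e : E} {u v : V} (he : e ∈ A) (h : G.IsLink e u v) :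
    G.comp A u = G.comp A v := Quot.sound ⟨e, he, h⟩

theorem IsLink.comp_eq_iff {A : Set E} {e : E} {u v : V} (h : G.IsLink e u v) :
    G.comp A u = G.comp A v ↔ G.EndsJoined A e := by
  obtain ⟨i, rfl, rfl⟩ := h
  cases i
  · rfl
  · exact eq_comm

theorem endsJoined_of_mem {A : Set E} {e : E} (he : e ∈ A) : G.EndsJoined A e :=
  (isLink_vert e false).comp_eq he

/-- The map of components induced by adding edges and deleting edges with joined ends. -/
def compMap {A B : Set E} (h : ∀ e ∈ A, G.EndsJoined B e) : G.Component A → G.Component B :=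
  Quot.lift (G.comp B) fun _ _ ⟨e, he, hl⟩ => hl.comp_eq_iff.2 (h e he)

theorem compMap_surjective {A B : Set E} (h : ∀ e ∈ A, G.EndsJoined B e) :
    Function.Surjective (compMap h) := by
  intro c
  obtain ⟨v, rfl⟩ := comp_surjective B c
  exact ⟨G.comp A v, rfl⟩

theorem k_empty : G.k ∅ = Nat.card V := by
  refine (Nat.card_eq_of_bijective (G.comp ∅) ⟨fun u v h => ?_, comp_surjective _⟩).symm
  have := congrArg (Quot.lift (fun v : V => v) (by rintro _ _ ⟨e, he, -⟩; exact he.elim)) h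
  exact this

variable [Finite V]

theorem k_le_of_endsJoined {A B : Set E} (h : ∀ e ∈ A, G.EndsJoined B e) : G.k B ≤ G.k A :=
  Nat.card_le_card_of_surjective _ (compMap_surjective h)

theorem k_anti {A B : Set E} (h : A ⊆ B) : G.k B ≤ G.k A :=
  k_le_of_endsJoined fun _ he => endsJoined_of_mem (h he)

theorem endsJoined_of_k_le {A : Set E} {e : E} (h : G.k A ≤ G.k (insert e A)) :
    G.EndsJoined A e := by
  by_contra hne
  refine (Nat.card_lt_card_of_surjective_of_eq
    (compMap (G := G) (A := A) (B := insert e A) fun _ he =>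
      endsJoined_of_mem (Set.mem_insert_of_mem _ he)) (compMap_surjective _) hne ?_).not_ge h
  exact endsJoined_of_mem (Set.mem_insert e A)

theorem k_le_k_insert_add_one (A : Set E) (e : E) : G.k A ≤ G.k (insert e A) + 1 := by
  classical
  let p := G.comp A (G.vert (e, false, false))
  let p' := G.comp A (G.vert (e, true, false))
  -- Redirecting `p` to `p'` makes the map respect the new edge; only `p` can then be missed, and
  -- `none` supplies it.
  let r : G.Component (insert e A) → G.Component A :=
    Quot.lift (fun v => if G.comp A v = p then p' else G.comp A v) (by
      rintro u v ⟨e', he', hl⟩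
      rcases he' with rfl | he'
      · obtain ⟨i, rfl, rfl⟩ := hl
        by_cases h : p' = p <;> cases i <;> simp [p, p'] at h ⊢
      · simp only [hl.comp_eq he'])
  have hr : Function.Surjective (fun c : Option (G.Component (insert e A)) => c.elim p r) := by
    intro c
    obtain ⟨v, rfl⟩ := comp_surjective A c
    by_cases h : G.comp A v = p
    · exact ⟨none, h.symm⟩
    · exact ⟨some (G.comp _ v), if_neg h⟩
  simpa [k, Finite.card_option] using Nat.card_le_card_of_surjective _ hr

theorem card_le_k_add_ncard [Finite E] (A : Set E) : Nat.card V ≤ G.k A + A.ncard := by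
  induction A, A.toFinite using Set.Finite.induction_on with
  | empty => simp [k_empty]
  | @insert e A he _ ih =>
    rw [Set.ncard_insert_of_notMem he]
    have := G.k_le_k_insert_add_one A e
    omega

end Components

/-! ### Cycles versus joined ends -/

section Cycles

variable {G}

theorem IsForest.subset {A B : Set E} (hB : G.IsForest B) (h : A ⊆ B) : G.IsForest A := by
  rintro ⟨n, v, e, hv, he, hl⟩
  exact hB ⟨n, v, e, hv, he, fun i => ⟨h (hl i).1, (hl i).2⟩⟩

/-- The simple graph underlying `(V, A)`. -/
def underlying (G : RibbonGraph V E) (A : Set E) : SimpleGraph V where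
  Adj u v := u ≠ v ∧ ∃ e ∈ A, G.IsLink e u v
  symm := ⟨fun _ _ ⟨hne, e, he, hl⟩ => ⟨hne.symm, e, he, hl.symm⟩⟩
  loopless := ⟨fun _ h => h.1 rfl⟩

theorem reachable_of_comp_eq {A : Set E} {u v : V} (h : G.comp A u = G.comp A v) :
    (G.underlying A).Reachable u v := by
  replace h := Quot.eqvGen_exact h
  induction h with
  | rel u v h =>
    by_cases huv : u = v
    · rw [huv]
    · exact SimpleGraph.Adj.reachable ⟨huv, h⟩
  | refl => rfl
  | symm _ _ _ ih => exact ih.symm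
  | trans _ _ _ _ _ ih₁ ih₂ => exact ih₁.trans ih₂

/-- A simple path in `A` between the ends of `e` is closed up by `e`; a loop gives the path of
length 0. -/
theorem containsCycle_insert {A : Set E} {e : E} (he : e ∉ A) (h : G.EndsJoined A e) :
    G.ContainsCycle (insert e A) := by
  classical
  obtain ⟨p, hp⟩ := (reachable_of_comp_eq h).exists_isPath
  have hinj := hp.getVert_injOn
  have hadj : ∀ i : Fin p.length, ∃ e' ∈ A, G.IsLink e' (p.getVert i) (p.getVert (i + 1)) :=
    fun i => (p.adj_getVert_succ i.2).2
  choose g hgA hg using hadj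
  have hglt : ∀ i j : Fin p.length, g i = g j → i = j := by
    intro i j hij
    have h₁ := (hg i).sym2_eq
    rw [hij, ← (hg j).sym2_eq, Sym2.eq_iff] at h₁
    have hi := i.2
    have hj := j.2
    rcases h₁ with ⟨h₁, -⟩ | ⟨h₁, h₂⟩
    · exact Fin.ext (hinj (by grind) (by grind) h₁)
    -- Traversing the same edge backwards would need `i = j + 1` and `i + 1 = j`.
    · have a := hinj (by grind) (by grind) h₁
      have b := hinj (by grind) (by grind) h₂
      omega
  refine ⟨p.length, fun i => p.getVert i, Fin.lastCases e g, ?_, ?_, ?_⟩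
  · intro i j hij
    exact Fin.ext (hinj (by simp; omega) (by simp; omega) hij)
  · intro i j
    induction i using Fin.lastCases with
    | last =>
      induction j using Fin.lastCases with
      | last => intro; rfl
      | cast j =>
        simp only [Fin.lastCases_last, Fin.lastCases_castSucc]
        intro h
        exact (he (h ▸ hgA j)).elim
    | cast i =>
      induction j using Fin.lastCases with
      | last =>
        simp only [Fin.lastCases_last, Fin.lastCases_castSucc]
        intro h
        exact (he (h ▸ hgA i)).elim
      | cast j =>
        simp only [Fin.lastCases_castSucc]
        intro h
        rw [hglt i j h]
  · intro i
    induction i using Fin.lastCases with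
    | last =>
      simp only [Fin.lastCases_last, Fin.last_add_one, Fin.val_last, Fin.val_zero,
        SimpleGraph.Walk.getVert_length, SimpleGraph.Walk.getVert_zero]
      exact ⟨Set.mem_insert _ _, isLink_vert e true⟩
    | cast i =>
      simp only [Fin.lastCases_castSucc, Fin.coeSucc_eq_succ, Fin.val_castSucc, Fin.val_succ]
      exact ⟨Set.mem_insert_of_mem _ (hgA i), hg i⟩

/-- The rest of the cycle is a path joining the ends of its last edge. -/
theorem ContainsCycle.exists_endsJoined {A : Set E} (h : G.ContainsCycle A) :
    ∃ e ∈ A, G.EndsJoined (A \ {e}) e := by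
  obtain ⟨n, v, e, -, he, hl⟩ := h
  refine ⟨e (Fin.last n), (hl _).1, ?_⟩
  have key : ∀ i : Fin (n + 1),
      G.comp (A \ {e (Fin.last n)}) (v 0) = G.comp (A \ {e (Fin.last n)}) (v i) := by
    intro i
    induction i using Fin.induction with
    | zero => rfl
    | succ i ih =>
      have hi := hl i.castSucc
      rw [Fin.coeSucc_eq_succ] at hi
      refine ih.trans (hi.2.comp_eq ⟨hi.1, fun h => ?_⟩)
      exact (Fin.castSucc_lt_last i).ne (he h)
  have hlast := (hl (Fin.last n)).2
  rw [Fin.last_add_one] at hlast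
  exact hlast.comp_eq_iff.1 (key _).symm

end Cycles

/-! ### Boundary components and the counting of forests -/

section Boundary

variable {G}

theorem boundaryStep_of_mem {A : Set E} {x : Corner E} (h : x.1 ∈ A) :
    boundaryStep A x = x.alongSide := if_pos h

theorem boundaryStep_of_notMem {A : Set E} {x : Corner E} (h : x.1 ∉ A) :
    boundaryStep A x = x.alongEnd := if_neg h

theorem boundaryStep_fst (A : Set E) (x : Corner E) : (boundaryStep A x).1 = x.1 := by
  by_cases h : x.1 ∈ A
  · rw [boundaryStep_of_mem h]; rfl
  · rw [boundaryStep_of_notMem h]; rfl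

theorem boundaryStep_boundaryStep (A : Set E) (x : Corner E) :
    boundaryStep A (boundaryStep A x) = x := by
  by_cases h : x.1 ∈ A
  · rw [boundaryStep_of_mem h, boundaryStep_of_mem (x := x.alongSide) h]; simp [Corner.alongSide]
  · rw [boundaryStep_of_notMem h, boundaryStep_of_notMem (x := x.alongEnd) h]; simp [Corner.alongEnd]

theorem boundaryStep_ne (A : Set E) (x : Corner E) : boundaryStep A x ≠ x := by
  by_cases h : x.1 ∈ A
  · rw [boundaryStep_of_mem h]; simp [Corner.alongSide, Prod.ext_iff]
  · rw [boundaryStep_of_notMem h]; simp [Corner.alongEnd, Prod.ext_iff]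

theorem boundaryStep_insert {A : Set E} {e : E} {x : Corner E} (h : x.1 ≠ e) :
    boundaryStep (insert e A) x = boundaryStep A x := by
  by_cases hx : x.1 ∈ A
  · rw [boundaryStep_of_mem hx, boundaryStep_of_mem (Set.mem_insert_of_mem e hx)]
  · rw [boundaryStep_of_notMem hx, boundaryStep_of_notMem (by simp [h, hx])]

theorem comp_vert_boundaryStep (A : Set E) (x : Corner E) :
    G.comp A (G.vert (boundaryStep A x)) = G.comp A (G.vert x) := by
  by_cases h : x.1 ∈ A
  · rw [boundaryStep_of_mem h]
    obtain ⟨e, i, s⟩ := x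
    simp only [Corner.alongSide]
    rw [vert_side, vert_side _ e i]
    exact ((isLink_vert e i).comp_eq h).symm
  · rw [boundaryStep_of_notMem h, vert_alongEnd]

/-- The component of `(V, A)` on which a boundary component lies. -/
def boundaryComp (G : RibbonGraph V E) (A : Set E) : G.BoundaryComponent A → G.Component A :=
  Sum.elim (Quot.lift (fun x => G.comp A (G.vert x)) (by
    rintro x _ (rfl | rfl)
    · rw [vert_arc]
    · rw [comp_vert_boundaryStep])) fun v => G.comp A v

theorem boundaryComp_surjective (A : Set E) : Function.Surjective (G.boundaryComp A) := by
  intro c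
  obtain ⟨v, rfl⟩ := comp_surjective A c
  by_cases h : v ∈ Set.range G.vert
  · obtain ⟨x, rfl⟩ := h
    exact ⟨.inl (Quot.mk _ x), rfl⟩
  · exact ⟨.inr ⟨v, h⟩, rfl⟩

theorem k_le_f [Finite V] [Finite E] (A : Set E) : G.k A ≤ G.f A :=
  Nat.card_le_card_of_surjective _ (boundaryComp_surjective A)

theorem f_empty_le [Finite V] : G.f ∅ ≤ Nat.card V := by
  have hstep : ∀ x : Corner E, boundaryStep ∅ x = x.alongEnd :=
    fun x => boundaryStep_of_notMem (Set.notMem_empty _)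
  refine Nat.card_le_card_of_injective (Sum.elim (Quot.lift G.vert ?_) Subtype.val) ?_
  · rintro x _ (rfl | rfl)
    · rw [vert_arc]
    · rw [hstep, vert_alongEnd]
  · rintro (⟨⟨x⟩⟩ | ⟨u, hu⟩) (⟨⟨y⟩⟩ | ⟨v, hv⟩) h
    · refine congrArg Sum.inl (Quot.eqvGen_sound ?_)
      simpa only [hstep] using (G.vert_eq_iff x y).1 h
    · exact (hv ⟨x, h⟩).elim
    · exact (hu ⟨y, h.symm⟩).elim
    · exact congrArg Sum.inr (Subtype.ext h)

/-- If a bridge `e` is added to `(V, A)`, the boundary leaving `e` at one corner of an end returns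
to `e` at the other corner of the same end. -/
theorem boundary_eq_of_not_endsJoined [Finite E] {A : Set E} {e : E}
    (hne : ¬ G.EndsJoined A e) (i : Bool) :
    (Quot.mk _ (e, i, false) :
      Quot fun x y : Corner E => y = G.arc x ∨ y = boundaryStep (insert e A) x) =
      Quot.mk _ (e, i, true) := by
  classical
  have := Fintype.ofFinite E
  -- `R` follows the boundary but stops on reaching a corner of `e`.
  let R : Corner E → Corner E → Prop := fun x y =>
    y = G.arc x ∨ (x.1 ≠ e ∧ y = boundaryStep A x)
  let a : Corner E := (e, i, false)
  by_cases hb : Relation.EqvGen R a (e, i, true)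
  · refine Quot.eqvGen_sound (hb.mono ?_)
    rintro x y (h | ⟨hx, h⟩)
    · exact .inl h
    · exact .inr (by rw [boundaryStep_insert hx, h])
  exfalso
  have hcomp : ∀ x y, Relation.EqvGen R x y →
      G.comp A (G.vert x) = G.comp A (G.vert y) := by
    intro x y hx
    clear hb
    induction hx with
    | rel x y h =>
      rcases h with rfl | ⟨-, rfl⟩
      · rw [vert_arc]
      · rw [comp_vert_boundaryStep]
    | refl => rfl
    | symm _ _ _ ih => exact ih.symm
    | trans _ _ _ _ _ ih₁ ih₂ => exact ih₁.trans ih₂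
  -- Parity: `C` avoids the other end of `e`, which lies in another component of `(V, A)`, so `a` is
  -- its only corner of `e`. The fixed-point-free involutions `arc` on `C` and `boundaryStep A` on
  -- `C \ {a}` make both cardinalities even.
  let C : Finset (Corner E) := Finset.univ.filter fun x => Relation.EqvGen R a x
  have hC : ∀ x, x ∈ C ↔ Relation.EqvGen R a x := fun x => by simp [C]
  have haC : a ∈ C := (hC a).2 (.refl _)
  have hfst : ∀ x ∈ C.erase a, x.1 ≠ e := by
    rintro ⟨e', j, s⟩ hx rfl
    obtain ⟨hxa, hx⟩ := Finset.mem_erase.1 hx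
    rw [hC] at hx
    by_cases hj : j = i
    · subst hj
      cases s
      · exact hxa rfl
      · exact hb hx
    · obtain rfl : j = !i := by cases i <;> cases j <;> simp_all
      have := hcomp _ _ hx
      rw [vert_side _ e' (!i)] at this
      exact hne ((isLink_vert e' i).comp_eq_iff.1 this)
  have h₁ : ∑ x ∈ C, (1 : ZMod 2) = 0 :=
    Finset.sum_involution (fun x _ => G.arc x) (fun _ _ => by decide)
      (fun x _ _ => G.arc_ne x)
      (fun x hx => (hC _).2 (((hC x).1 hx).trans _ _ _ (.rel _ _ (.inl rfl))))
      (fun x _ => G.arc_arc x)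
  have h₂ : ∑ x ∈ C.erase a, (1 : ZMod 2) = 0 := by
    refine Finset.sum_involution (fun x _ => boundaryStep A x) (fun _ _ => by decide)
      (fun x _ _ => boundaryStep_ne A x) (fun x hx => ?_)
      (fun x _ => boundaryStep_boundaryStep A x)
    have hxe := hfst x hx
    refine Finset.mem_erase.2 ⟨fun h => hxe ?_, (hC _).2 ?_⟩
    · rw [← boundaryStep_fst A x, h]
    · exact ((hC x).1 (Finset.mem_of_mem_erase hx)).trans _ _ _ (.rel _ _ (.inr ⟨hxe, rfl⟩))
  rw [← Finset.sum_erase_add C _ haC, h₂] at h₁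
  exact absurd h₁ (by decide)

/-- By the previous lemma, old boundary components map onto new ones. Those at the two ends of `e`
differ, lying in different components of `(V, A)`, but a side of `e` identifies them. -/
theorem f_insert_lt [Finite V] [Finite E] {A : Set E} {e : E} (he : e ∉ A)
    (hne : ¬ G.EndsJoined A e) : G.f (insert e A) < G.f A := by
  let q : (Quot fun x y : Corner E => y = G.arc x ∨ y = boundaryStep A x) →
      Quot fun x y : Corner E => y = G.arc x ∨ y = boundaryStep (insert e A) x :=
    Quot.lift (Quot.mk _) (by
      rintro x _ (rfl | rfl)
      · exact Quot.sound (.inl rfl)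
      · by_cases hx : x.1 = e
        · obtain ⟨e, i, s⟩ := x
          subst hx
          have := boundary_eq_of_not_endsJoined hne i
          rw [boundaryStep_of_notMem he]
          cases s
          · exact this
          · exact this.symm
        · rw [← boundaryStep_insert hx]
          exact Quot.sound (.inr rfl))
  have hq : Function.Surjective q := by
    rintro ⟨x⟩
    exact ⟨Quot.mk _ x, rfl⟩
  refine Nat.card_lt_card_of_surjective_of_eq (Sum.map q id)
    (hq.sumMap Function.surjective_id)
    (a := .inl (Quot.mk _ (e, false, false))) (b := .inl (Quot.mk _ (e, true, false)))
    (fun h => hne (congrArg (G.boundaryComp A) h)) (congrArg Sum.inl (Quot.sound (.inr ?_)))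
  rw [boundaryStep_of_mem (Set.mem_insert e A)]
  rfl

theorem IsForest.f_add_ncard_le [Finite V] [Finite E] {A : Set E} (hA : G.IsForest A) :
    G.f A + A.ncard ≤ Nat.card V := by
  induction A, A.toFinite using Set.Finite.induction_on with
  | empty => simpa using f_empty_le
  | @insert e A he _ ih =>
    have := ih (hA.subset (Set.subset_insert e A))
    have := f_insert_lt he fun h => hA (containsCycle_insert he h)
    rw [Set.ncard_insert_of_notMem he]
    omega

theorem IsForest.k_add_ncard [Finite V] [Finite E] {A : Set E} (hA : G.IsForest A) :
    G.k A + A.ncard = Nat.card V := by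
  have := hA.f_add_ncard_le
  have := G.k_le_f A
  have := G.card_le_k_add_ncard A
  omega

theorem isForest_iff [Finite V] [Finite E] {A : Set E} :
    G.IsForest A ↔ G.k A + A.ncard = Nat.card V := by
  refine ⟨IsForest.k_add_ncard, fun h hcyc => ?_⟩
  obtain ⟨e, he, hj⟩ := hcyc.exists_endsJoined
  -- Deleting an edge of a cycle keeps `k` but lowers `|A|`, breaking `|V| ≤ k + |A|`.
  have hk : G.k (A \ {e}) ≤ G.k A := k_le_of_endsJoined fun e' he' => by
    by_cases hee : e' = e
    · rwa [hee]
    · exact endsJoined_of_mem ⟨he', hee⟩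
  have := G.card_le_k_add_ncard (A \ {e})
  have := Set.ncard_sdiff_singleton_add_one he
  omega

theorem maximal_isForest_iff [Finite V] [Finite E] {B : Set E} :
    Maximal G.IsForest B ↔ G.k B = G.k Set.univ ∧ G.k B + B.ncard = Nat.card V := by
  constructor
  · intro h
    have hB := h.prop.k_add_ncard
    refine ⟨le_antisymm (k_le_of_endsJoined fun e _ => ?_) (k_anti (Set.subset_univ _)), hB⟩
    by_cases he : e ∈ B
    · exact endsJoined_of_mem he
    · refine endsJoined_of_k_le ?_
      have hnot : ¬ G.IsForest (insert e B) := fun hf =>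
        he (h.le_of_ge hf (Set.subset_insert e B) (Set.mem_insert e B))
      have h₁ := G.card_le_k_add_ncard (insert e B)
      rw [isForest_iff] at hnot
      rw [Set.ncard_insert_of_notMem he] at h₁ hnot
      omega
  · rintro ⟨hk, hB⟩
    refine ⟨isForest_iff.2 hB, fun B' hB' hle => ?_⟩
    have h₁ := hB'.k_add_ncard
    have h₂ : G.k Set.univ ≤ G.k B' := k_anti (Set.subset_univ _)
    exact (Set.eq_of_subset_of_ncard_le hle (by omega)).ge

theorem exists_maximal_isForest [Finite E] : ∃ B, Maximal G.IsForest B := by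
  have h0 : G.IsForest ∅ := fun ⟨_, _, _, _, _, h⟩ => (h 0).1
  obtain ⟨B, -, hB⟩ := (Set.toFinite {A | G.IsForest A}).exists_le_maximal h0
  exact ⟨B, hB⟩

end Boundary

/-! ### Smallest quasi-trees are maximal forests -/

section QuasiTrees

variable {G} [Finite V] [Finite E]

theorem k_eq_of_mem_feasible {A : Set E} (h : A ∈ G.deltaMatroid.feasible) :
    G.k A = G.k Set.univ := by
  have h₁ : G.f A = G.k Set.univ := h
  have h₂ := G.k_le_f A
  have h₃ : G.k Set.univ ≤ G.k A := k_anti (Set.subset_univ _)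
  omega

theorem mem_cycleMatroid_iff {A : Set E} : A ∈ G.cycleMatroid.feasible ↔
    A ∈ G.deltaMatroid.feasible ∧ G.k Set.univ + A.ncard = Nat.card V := by
  refine maximal_isForest_iff.trans ⟨fun ⟨h₁, h₂⟩ => ⟨?_, h₁ ▸ h₂⟩, fun ⟨h₁, h₂⟩ => ?_⟩
  · have h₃ := (isForest_iff.2 h₂).f_add_ncard_le
    have h₄ := G.k_le_f A
    change G.f A = _
    omega
  · have := k_eq_of_mem_feasible h₁
    exact ⟨this, this ▸ h₂⟩

theorem card_le_of_mem_feasible {A : Set E} (h : A ∈ G.deltaMatroid.feasible) :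
    Nat.card V ≤ G.k Set.univ + A.ncard :=
  k_eq_of_mem_feasible h ▸ G.card_le_k_add_ncard A

theorem lower_deltaMatroid (G : RibbonGraph V E) : G.deltaMatroid.lower = G.cycleMatroid := by
  obtain ⟨B, hB⟩ := G.exists_maximal_isForest
  obtain ⟨hBf, hBc⟩ := mem_cycleMatroid_iff.1 hB
  ext A
  rw [mem_cycleMatroid_iff]
  refine and_congr_right fun hA => ⟨fun h => ?_, fun h F hF => ?_⟩
  · have := h B hBf
    have := card_le_of_mem_feasible hA
    omega
  · have := card_le_of_mem_feasible hF
    omega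

end QuasiTrees

/-! ### Boundary and components of the geometric dual -/

section Dual

variable {G}

theorem boundaryStep_compl_swap (A : Set E) (x : Corner E) :
    boundaryStep Aᶜ x.swap = (boundaryStep A x).swap := by
  by_cases h : x.1 ∈ A
  · rw [boundaryStep_of_mem h, boundaryStep_of_notMem (not_not.2 h)]; rfl
  · rw [boundaryStep_of_notMem h, boundaryStep_of_mem (x := x.swap) (A := Aᶜ) h]; rfl

theorem range_vert_dual : Set.range G.dual.vert = Set.range Sum.inl := by
  ext c
  constructor
  · rintro ⟨x, rfl⟩
    exact ⟨_, rfl⟩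
  · rintro ⟨⟨x⟩, rfl⟩
    exact ⟨x.swap, rfl⟩

theorem f_dual_compl (A : Set E) : G.dual.f Aᶜ = G.f A := by
  let s : Corner E ≃ Corner E := ⟨Corner.swap, Corner.swap, fun _ => rfl, fun _ => rfl⟩
  have hs : Function.Injective (Corner.swap (E := E)) := s.injective
  let e₁ : (Quot fun x y : Corner E => y = G.arc x ∨ y = boundaryStep A x) ≃
      Quot fun x y : Corner E => y = G.dual.arc x ∨ y = boundaryStep Aᶜ x :=
    Quot.congr s fun x y => by
      change _ ↔ (y.swap = (G.arc x).swap ∨ y.swap = boundaryStep Aᶜ x.swap)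
      rw [boundaryStep_compl_swap, hs.eq_iff, hs.eq_iff]
  let e₂ : {v : V // v ∉ Set.range G.vert} ≃
      {c : G.BoundaryComponent Set.univ // c ∉ Set.range G.dual.vert} :=
    Equiv.ofBijective (fun v => ⟨.inr v, by simp [range_vert_dual]⟩)
      ⟨fun u v h => by simpa using h, by
      rintro ⟨c | v, hc⟩
      · exact (hc (by simp [range_vert_dual])).elim
      · exact ⟨v, rfl⟩⟩
  exact (Nat.card_congr (Equiv.sumCongr e₁ e₂)).symm

theorem k_dual [Finite V] [Finite E] : G.dual.k Set.univ = G.k Set.univ := by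
  classical
  apply le_antisymm
  · let c : Corner E → G.dual.Component Set.univ := fun x =>
      G.dual.comp _ (.inl (Quot.mk _ x))
    have hside : ∀ x, c x.alongSide = c x := fun x => by
      refine congrArg (G.dual.comp _) (congrArg Sum.inl (Quot.sound (.inr ?_)).symm)
      rw [boundaryStep_of_mem (Set.mem_univ _)]
    -- An end of `e` in `G` runs between the two sides, which are the ends of `e` in `G*`; so the
    -- edge `e` of `G*` connects them.
    have hend : ∀ x, c x.alongEnd = c x := by
      rintro ⟨e, i, s⟩
      have h : ∀ i s, c (e, i, s) = c (e, false, s) := fun i s => by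
        cases i
        · rfl
        · exact hside (e, false, s)
      change c (e, i, !s) = _
      rw [h, h i]
      exact ((isLink_vert (G := G.dual) e s).comp_eq (Set.mem_univ _)).symm
    have hvert : ∀ x y, G.vert x = G.vert y → c x = c y := by
      intro x y h
      rw [G.vert_eq_iff] at h
      induction h with
      | rel x y h =>
        rcases h with rfl | rfl
        · exact congrArg (G.dual.comp _) (congrArg Sum.inl (Quot.sound (.inl rfl)))
        · exact (hend x).symm
      | refl => rfl
      | symm _ _ _ ih => exact ih.symm
      | trans _ _ _ _ _ ih₁ ih₂ => exact ih₁.trans ih₂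
    let ψ : V → G.dual.Component Set.univ := fun v =>
      if h : v ∈ Set.range G.vert then c h.choose else G.dual.comp _ (.inr ⟨v, h⟩)
    have hψ : ∀ x, ψ (G.vert x) = c x := fun x => by
      have h : G.vert x ∈ Set.range G.vert := ⟨x, rfl⟩
      exact (dif_pos h).trans (hvert _ _ h.choose_spec)
    refine Nat.card_le_card_of_surjective (Quot.lift ψ ?_) ?_
    · rintro _ _ ⟨e, -, i, rfl, rfl⟩
      rw [hψ, hψ]
      exact (hside (e, i, false)).symm
    · intro d
      obtain ⟨⟨⟨x⟩⟩ | ⟨v, hv⟩, rfl⟩ := comp_surjective _ d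
      · exact ⟨Quot.mk _ (G.vert x), hψ x⟩
      · exact ⟨Quot.mk _ v, dif_neg hv⟩
  -- Conversely, the two sides of an edge meet a common vertex of `G`, so links of `G*` stay within
  -- a component.
  · refine Nat.card_le_card_of_surjective (Quot.lift (G.boundaryComp Set.univ) ?_) ?_
    · rintro _ _ ⟨e, -, i, rfl, rfl⟩
      exact congrArg (G.comp _) (G.vert_alongEnd (e, false, i)).symm
    · intro d
      obtain ⟨b, rfl⟩ := boundaryComp_surjective _ d
      exact ⟨Quot.mk _ b, rfl⟩

end Dual

end RibbonGraph

/-! ### Duality of set systems -/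

namespace SetSystem

variable {E : Type*} {D : SetSystem E}

theorem mem_dual_feasible {A : Set E} : A ∈ D.dual.feasible ↔ Aᶜ ∈ D.feasible := by
  have h : ∀ X : Set E, symmDiff Set.univ X = Xᶜ := fun X => top_symmDiff X
  constructor
  · rintro ⟨X, hX, rfl⟩
    rwa [h, compl_compl]
  · intro hA
    exact ⟨_, hA, by rw [h, compl_compl]⟩

theorem upper_dual [Finite E] : D.dual.upper = D.lower.dual := by
  ext A
  rw [mem_dual_feasible]
  refine and_congr mem_dual_feasible ⟨fun h F hF => ?_, fun h F hF => ?_⟩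
  · have h₁ := h Fᶜ (mem_dual_feasible.2 (by rwa [compl_compl]))
    have := Set.ncard_add_ncard_compl A
    have := Set.ncard_add_ncard_compl F
    omega
  · have h₁ := h Fᶜ (mem_dual_feasible.1 hF)
    have := Set.ncard_add_ncard_compl A
    have := Set.ncard_add_ncard_compl F
    omega

end SetSystem

/-! ### Largest quasi-trees and the Euler genus -/

namespace RibbonGraph

variable {V E : Type*} [Finite V] [Finite E] (G : RibbonGraph V E)

theorem deltaMatroid_eq_dual : G.deltaMatroid = G.dual.deltaMatroid.dual := by
  ext A
  rw [SetSystem.mem_dual_feasible]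
  change G.f A = _ ↔ G.dual.f Aᶜ = _
  rw [f_dual_compl, k_dual]

theorem upper_deltaMatroid : G.deltaMatroid.upper = G.dual.cycleMatroid.dual := by
  rw [deltaMatroid_eq_dual, SetSystem.upper_dual, lower_deltaMatroid]

/-- The largest and the smallest quasi-trees differ in size by the Euler genus. -/
theorem exists_ncard_eq_add_eulerGenus : ∃ A ∈ G.cycleMatroid.feasible,
    ∃ B ∈ G.deltaMatroid.feasible, (∀ F ∈ G.deltaMatroid.feasible, F.ncard ≤ B.ncard) ∧
      (B.ncard : ℤ) = A.ncard + G.eulerGenus := by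
  obtain ⟨A, hA⟩ := G.exists_maximal_isForest
  obtain ⟨T, hT⟩ := G.dual.exists_maximal_isForest
  have hB : Tᶜ ∈ G.deltaMatroid.upper.feasible := by
    rw [upper_deltaMatroid, SetSystem.mem_dual_feasible, compl_compl]
    exact hT
  have hA' := (mem_cycleMatroid_iff.1 hA).2
  have hT := (mem_cycleMatroid_iff.1 hT).2
  refine ⟨A, hA, Tᶜ, hB.1, hB.2, ?_⟩
  have hc := Set.ncard_add_ncard_compl T
  rw [k_dual] at hT
  -- The vertices of `G*` are by definition the boundary components of `G`.
  change _ = G.f Set.univ at hT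
  unfold eulerGenus
  omega

theorem deltaMatroid_eq_cycleMatroid_iff : G.deltaMatroid = G.cycleMatroid ↔ G.IsPlane := by
  obtain ⟨A, hA, B, hB, hmax, h⟩ := G.exists_ncard_eq_add_eulerGenus
  have hA' := (mem_cycleMatroid_iff.1 hA).2
  unfold IsPlane
  constructor
  · intro heq
    have hB' := (mem_cycleMatroid_iff.1 (heq ▸ hB)).2
    omega
  · intro h0
    ext F
    rw [mem_cycleMatroid_iff]
    refine ⟨fun hF => ⟨hF, ?_⟩, And.left⟩
    have := hmax F hF
    have := card_le_of_mem_feasible hF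
    omega

theorem not_isMatroid_of_not_isPlane (h : ¬ G.IsPlane) : ¬ G.deltaMatroid.IsMatroid := by
  obtain ⟨A, hA, B, hB, -, hAB⟩ := G.exists_ncard_eq_add_eulerGenus
  intro hM
  have := hM.2 A (mem_cycleMatroid_iff.1 hA).1 B hB
  exact h (by unfold IsPlane; omega)

end RibbonGraph

theorem corollaryc {V E : Type*} [Finite V] [Finite E] (G : RibbonGraph V E) :
    G.deltaMatroid.lower = G.cycleMatroid ∧
    G.deltaMatroid.upper = G.dual.cycleMatroid.dual ∧
    (G.deltaMatroid = G.cycleMatroid ↔ G.IsPlane) ∧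
    (¬ G.IsPlane → ¬ G.deltaMatroid.IsMatroid) :=
  ⟨G.lower_deltaMatroid, G.upper_deltaMatroid, G.deltaMatroid_eq_cycleMatroid_iff,
    G.not_isMatroid_of_not_isPlane⟩
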